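/- All graphs are finite, simple and undirected. For a connected graph $G$ with vertices $v_1,\dots,v_n$, the distance spectral radius $\rho(G)$ is the largest eigenvalue of the distance matrix $(d_G(v_i,v_j))_{i,j}$. A graph is $k$-chromatic if its chromatic number is $k$, and $k$-critical if it is $k$-chromatic and every proper subgraph has chromatic number less than $k$. Let $G$ be a graph that maximizes $\rho$ among all connected $k$-chromatic graphs of order $n$. Then $G$ has a $k$-critical subgraph $H$ such that $G$ is obtained from $H$ by attaching paths at vertices of $H$; that is, for each $v\in V(H)$ there is a path $P_v$ in $G$ (possibly trivial, i.e. of length $0$) having $v$ as an end vertex, such that $V(P_v)\cap V(H)=\{v\}$, the paths $P_v$ are pairwise vertex-disjoint, and $G=H\cup\bigcup_{v\in V(H)}P_v$. Moreover, $H$ and these paths can be chosen so that the set $S=\{v\in V(H): P_v \text{ has positive length}\}$ is an independent set of $H$. -/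

import Mathlib

universe u

namespace SimpleGraph

/-- The distance matrix of a graph. -/
noncomputable def distanceMatrix {V : Type u} (G : SimpleGraph V) : Matrix V V ℝ :=
  Matrix.of fun u v => (G.dist u v : ℝ)

/-- The distance spectral radius: the largest (real) eigenvalue of the distance matrix. -/
noncomputable def distanceSpectralRadius {V : Type u} [Fintype V] (G : SimpleGraph V) : ℝ :=
  sSup {μ : ℝ | Module.End.HasEigenvalue G.distanceMatrix.mulVecLin μ}

/-- The supremum in the definition is attained, so it is a genuine largest eigenvalue. -/
theorem isGreatest_distanceSpectralRadius {V : Type u} [Fintype V] [Nonempty V]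
    (G : SimpleGraph V) :
    IsGreatest {μ : ℝ | Module.End.HasEigenvalue G.distanceMatrix.mulVecLin μ}
      G.distanceSpectralRadius := by
  classical
  have hfin : {μ : ℝ | Module.End.HasEigenvalue G.distanceMatrix.mulVecLin μ}.Finite :=
    Module.End.finite_hasEigenvalue _
  have hD : G.distanceMatrix.IsHermitian := by
    ext u v
    simp [distanceMatrix, SimpleGraph.dist_comm]
  have hne : {μ : ℝ | Module.End.HasEigenvalue G.distanceMatrix.mulVecLin μ}.Nonempty := by
    obtain ⟨i⟩ := ‹Nonempty V›
    refine ⟨hD.eigenvalues i, ?_⟩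
    have h := hD.eigenvalues_mem_spectrum_real i
    rw [← Matrix.spectrum_toLin', ← Module.End.hasEigenvalue_iff_mem_spectrum] at h
    simpa [Matrix.toLin'_apply'] using h
  exact ⟨hne.csSup_mem hfin, fun μ hμ => le_csSup hfin.bddAbove hμ⟩

/-- Membership in the family of connected `k`-chromatic graphs of order `n`. -/
structure InChromaticFamily (k n : ℕ) {V : Type u} [Fintype V] (G : SimpleGraph V) : Prop where
  card_eq : Fintype.card V = n
  connected : G.Connected
  chromaticNumber_eq : G.chromaticNumber = (k : ℕ∞)

/-- `G` maximizes the distance spectral radius among all connected `k`-chromatic graphs of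
order `n`. -/
def MaximizesDistanceSpectralRadius (k n : ℕ) {V : Type u} [Fintype V]
    (G : SimpleGraph V) : Prop :=
  G.InChromaticFamily k n ∧
    ∀ (W : Type u) [Fintype W] (G' : SimpleGraph W), G'.InChromaticFamily k n →
      G'.distanceSpectralRadius ≤ G.distanceSpectralRadius

/-- A graph is `k`-critical if it is `k`-chromatic and every proper subgraph has a smaller
chromatic number. -/
def IsCritical (k : ℕ) {V : Type u} (G : SimpleGraph V) : Prop :=
  G.chromaticNumber = (k : ℕ∞) ∧
    ∀ K : G.Subgraph, K ≠ ⊤ → K.coe.chromaticNumber < (k : ℕ∞)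

/-- A presentation of `G` as obtained from its subgraph `H` by attaching a path (possibly of
length `0`) at each vertex `v` of `H`, with `v` an end vertex of the path: the path at `v` meets
`H` only in `v`, paths at distinct vertices are disjoint, and `G` is the union of `H` and all
the paths. -/
structure PathAttachment {V : Type u} {G : SimpleGraph V} (H : G.Subgraph) where
  endpoint : H.verts → V
  path : ∀ v : H.verts, G.Walk (v : V) (endpoint v)
  isPath : ∀ v, (path v).IsPath
  eq_of_mem : ∀ (v : H.verts) (x : V), x ∈ (path v).support → x ∈ H.verts → x = v
  disjoint : ∀ v w : H.verts, v ≠ w → List.Disjoint (path v).support (path w).support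
  union_eq : H ⊔ ⨆ v, (path v).toSubgraph = ⊤

/-- The vertices of `H` at which nontrivial paths (paths of positive length) are attached. -/
def PathAttachment.nontrivialVerts {V : Type u} {G : SimpleGraph V} {H : G.Subgraph}
    (A : PathAttachment H) : Set H.verts :=
  {v | 0 < (A.path v).length}

end SimpleGraph

/-! The engine is an averaging form of the Rayleigh principle, `two_mul_dist_eq`. Suppose `G` is a
maximizer and `G₁`, `G₂` lie in the same family on the same vertices. If the average of their
distances dominates the distance of `G` for every pair, then equality holds for every pair. This is
because the Perron vector of `G` has positive entries. A modification of `G` whose average strictly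
gains somewhere is therefore impossible.

Fix a `k`-critical subgraph `H`; it is connected. Three modifications are used. (1) Deleting an edge
outside `H` that is not a bridge lengthens distances, so all edges outside `H` are bridges
(`isBridge`). (2) If a vertex has three neighbours and at least two of these edges lie outside `H`,
the branch behind one of the two can be reattached at either remaining neighbour; on average this
lengthens distances (`not_three_adj`). Hence each vertex of `H` carries at most one outside edge and
vertices off `H` have degree at most two, which makes `G` equal to `H` with paths attached. (3) If
branches hang at both ends of an edge `uv` of `H`, the rest of the graph can be slid one step
towards either branch. The gains and losses towards the two branches cancel, while distances from
any further vertex of `H` to `u` and `v` grow in total (`not_adj_of_branches`). Hence `S` is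
independent.

Slide (3) needs a third vertex in `H`, so `k ≥ 3`. For `k = 2`, `H` is instead chosen inside an edge
at a leaf, so that at most one vertex carries a path. -/

namespace SimpleGraph

variable {V : Type u}

/-! ### Rayleigh quotients and the averaging principle. -/

section Spectral

theorem distanceMatrix_isHermitian (G : SimpleGraph V) : G.distanceMatrix.IsHermitian := by
  ext u v
  simp [distanceMatrix, SimpleGraph.dist_comm]

variable [Fintype V]

/-- An eigenvalue `μ` of the difference yields the eigenvalue `ρ - μ` of the distance matrix, which
is at most `ρ`. -/
theorem posSemidef_distanceSpectralRadius_sub [DecidableEq V] [Nonempty V] (G : SimpleGraph V) :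
    (G.distanceSpectralRadius • (1 : Matrix V V ℝ) - G.distanceMatrix).PosSemidef := by
  have hA : (G.distanceSpectralRadius • (1 : Matrix V V ℝ) - G.distanceMatrix).IsHermitian := by
    refine Matrix.IsHermitian.sub ?_ G.distanceMatrix_isHermitian
    ext i j
    simp [Matrix.one_apply, eq_comm]
  rw [hA.posSemidef_iff_eigenvalues_nonneg]
  intro i
  have hv := hA.mulVec_eigenvectorBasis i
  set y : V → ℝ := (hA.eigenvectorBasis i).ofLp with hy
  have hy0 : y ≠ 0 := by
    intro h
    have := hA.eigenvectorBasis.orthonormal.ne_zero i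
    apply this
    ext j
    exact congrFun h j
  have hev : Module.End.HasEigenvalue G.distanceMatrix.mulVecLin
      (G.distanceSpectralRadius - hA.eigenvalues i) := by
    refine Module.End.hasEigenvalue_of_hasEigenvector (x := y) ⟨?_, hy0⟩
    rw [Module.End.mem_eigenspace_iff, Matrix.mulVecLin_apply]
    rw [Matrix.sub_mulVec, Matrix.smul_mulVec, Matrix.one_mulVec] at hv
    rw [sub_smul, ← hv]
    abel
  have := G.isGreatest_distanceSpectralRadius.2 hev
  simp only [Pi.zero_apply]
  linarith

/-- The quadratic form of the distance matrix is bounded by the distance spectral radius. -/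
theorem sum_mul_dist_le [Nonempty V] (G : SimpleGraph V) (x : V → ℝ) :
    ∑ i, ∑ j, x i * x j * G.dist i j ≤ G.distanceSpectralRadius * ∑ i, x i ^ 2 := by
  classical
  have h := G.posSemidef_distanceSpectralRadius_sub.dotProduct_mulVec_nonneg x
  rw [Matrix.sub_mulVec, Matrix.smul_mulVec, Matrix.one_mulVec, dotProduct_sub] at h
  simp only [star_trivial, dotProduct, Pi.smul_apply, smul_eq_mul, Matrix.mulVec, distanceMatrix,
    Matrix.of_apply, Finset.mul_sum] at h
  rw [Finset.mul_sum]
  calc _ = ∑ i, ∑ j, x i * (G.dist i j * x j) :=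
        Finset.sum_congr rfl fun i _ => Finset.sum_congr rfl fun j _ => by ring
    _ ≤ ∑ i, x i * (G.distanceSpectralRadius * x i) := by linarith
    _ = _ := Finset.sum_congr rfl fun i _ => by ring

/-- A connected graph has a positive vector attaining the distance spectral radius. -/
theorem Connected.exists_pos_sum_mul_dist_eq {G : SimpleGraph V} (hG : G.Connected) :
    ∃ x : V → ℝ, (∀ i, 0 < x i) ∧
      ∑ i, ∑ j, x i * x j * G.dist i j = G.distanceSpectralRadius * ∑ i, x i ^ 2 := by
  classical
  have := hG.nonempty
  obtain ⟨y, hy, hy0⟩ := G.isGreatest_distanceSpectralRadius.1.exists_hasEigenvector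
  rw [Module.End.mem_eigenspace_iff, Matrix.mulVecLin_apply] at hy
  have hyi : ∀ i, ∑ j, G.dist i j * y j = G.distanceSpectralRadius * y i := fun i => by
    simpa [Matrix.mulVec, dotProduct, distanceMatrix] using congrFun hy i
  have hq : ∑ i, ∑ j, y i * y j * G.dist i j = G.distanceSpectralRadius * ∑ i, y i ^ 2 := by
    rw [Finset.mul_sum]
    refine Finset.sum_congr rfl fun i _ => ?_
    rw [pow_two, mul_left_comm, ← hyi i, Finset.mul_sum]
    exact Finset.sum_congr rfl fun j _ => by ring
  have hle : ∑ i, ∑ j, y i * y j * G.dist i j ≤ ∑ i, ∑ j, |y i| * |y j| * G.dist i j := by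
    refine Finset.sum_le_sum fun i _ => Finset.sum_le_sum fun j _ => ?_
    rw [← abs_mul]
    exact mul_le_mul_of_nonneg_right (le_abs_self _) (Nat.cast_nonneg _)
  have hqa : ∑ i, ∑ j, |y i| * |y j| * G.dist i j =
      G.distanceSpectralRadius * ∑ i, |y i| ^ 2 := by
    refine le_antisymm (G.sum_mul_dist_le fun i => |y i|) ?_
    simp only [sq_abs]
    rw [← hq]
    exact hle
  -- A zero of a positive semidefinite form lies in its kernel, so `|y|` is again an eigenvector for
  -- `ρ`.
  have hker := (G.posSemidef_distanceSpectralRadius_sub.dotProduct_mulVec_zero_iff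
    (fun i => |y i|)).1 (by
      rw [Matrix.sub_mulVec, Matrix.smul_mulVec, Matrix.one_mulVec, dotProduct_sub, sub_eq_zero]
      simp only [star_trivial, dotProduct, Pi.smul_apply, smul_eq_mul, Matrix.mulVec,
        distanceMatrix, Matrix.of_apply, Finset.mul_sum]
      rw [Finset.mul_sum] at hqa
      calc _ = ∑ i, G.distanceSpectralRadius * |y i| ^ 2 :=
            Finset.sum_congr rfl fun i _ => by ring
        _ = ∑ i, ∑ j, |y i| * |y j| * G.dist i j := hqa.symm
        _ = _ := Finset.sum_congr rfl fun i _ => Finset.sum_congr rfl fun j _ => by ring)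
  have hi : ∀ i, ∑ j, G.dist i j * |y j| = G.distanceSpectralRadius * |y i| := fun i => by
    have := congrFun hker i
    simp only [Matrix.sub_mulVec, Matrix.smul_mulVec, Matrix.one_mulVec, Pi.sub_apply,
      Pi.smul_apply, smul_eq_mul, Pi.zero_apply, sub_eq_zero] at this
    simpa [Matrix.mulVec, dotProduct, distanceMatrix] using this.symm
  -- A zero entry of `|y|` would force all other entries to vanish, since off-diagonal distances are
  -- positive.
  refine ⟨fun i => |y i|, fun i => abs_pos.2 fun h0 => hy0 ?_, hqa⟩
  have hs := hi i
  rw [h0, abs_zero, mul_zero, Finset.sum_eq_zero_iff_of_nonneg fun j _ => by positivity] at hs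
  ext j
  by_cases hij : i = j
  · rw [← hij, h0, Pi.zero_apply]
  · have h1 := hs j (Finset.mem_univ j)
    have h2 := hG.pos_dist_of_ne hij
    rcases mul_eq_zero.1 h1 with h | h
    · norm_cast at h; omega
    · simpa using h

/-- Testing `G₁` and `G₂` on the Perron vector of `G` shows that the weighted sum of the nonnegative
excesses is at most zero; the weights are positive, so each excess vanishes. Taking two graphs lets
the losses of one be paid by the gains of the other. -/
theorem MaximizesDistanceSpectralRadius.two_mul_dist_eq {k n : ℕ} {G G₁ G₂ : SimpleGraph V}
    (hG : G.MaximizesDistanceSpectralRadius k n) (h₁ : G₁.InChromaticFamily k n)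
    (h₂ : G₂.InChromaticFamily k n)
    (hle : ∀ i j, 2 * G.dist i j ≤ G₁.dist i j + G₂.dist i j) (i j : V) :
    2 * G.dist i j = G₁.dist i j + G₂.dist i j := by
  have := hG.1.connected.nonempty
  obtain ⟨x, hx, hxe⟩ := hG.1.connected.exists_pos_sum_mul_dist_eq
  have hs : 0 ≤ ∑ i, x i ^ 2 := Finset.sum_nonneg fun i _ => sq_nonneg _
  have e₁ := (G₁.sum_mul_dist_le x).trans (mul_le_mul_of_nonneg_right (hG.2 V G₁ h₁) hs)
  have e₂ := (G₂.sum_mul_dist_le x).trans (mul_le_mul_of_nonneg_right (hG.2 V G₂ h₂) hs)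
  rw [← hxe] at e₁ e₂
  have hterm : ∀ i j, 0 ≤ x i * x j * ((G₁.dist i j + G₂.dist i j - 2 * G.dist i j : ℝ)) := by
    intro i j
    have : (2 * G.dist i j : ℝ) ≤ G₁.dist i j + G₂.dist i j := by exact_mod_cast hle i j
    exact mul_nonneg (mul_pos (hx i) (hx j)).le (by linarith)
  have hsum : ∑ i, ∑ j, x i * x j * ((G₁.dist i j + G₂.dist i j - 2 * G.dist i j : ℝ)) = 0 := by
    refine le_antisymm ?_ (Finset.sum_nonneg fun i _ => Finset.sum_nonneg fun j _ => hterm i j)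
    calc _ = ∑ i, ∑ j, x i * x j * G₁.dist i j + ∑ i, ∑ j, x i * x j * G₂.dist i j
          - 2 * ∑ i, ∑ j, x i * x j * G.dist i j := by
          simp only [Finset.mul_sum, ← Finset.sum_add_distrib, ← Finset.sum_sub_distrib]
          exact Finset.sum_congr rfl fun i _ => Finset.sum_congr rfl fun j _ => by ring
      _ ≤ 0 := by linarith
  rw [Finset.sum_eq_zero_iff_of_nonneg fun i _ => Finset.sum_nonneg fun j _ => hterm i j] at hsum
  have h := hsum i (Finset.mem_univ i)
  rw [Finset.sum_eq_zero_iff_of_nonneg fun j _ => hterm i j] at h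
  have h := (mul_eq_zero.1 (h j (Finset.mem_univ j))).resolve_left (mul_pos (hx i) (hx j)).ne'
  have h : (2 * G.dist i j : ℝ) = G₁.dist i j + G₂.dist i j := by linarith
  exact_mod_cast h

end Spectral

/-! ### Comparing distances by potentials and contractions. -/

section Metric

theorem Reachable.of_forall_adj {W : Type*} {G : SimpleGraph V} {G' : SimpleGraph W} (f : V → W)
    (hf : ∀ a b, G.Adj a b → G'.Reachable (f a) (f b)) {a b : V} (h : G.Reachable a b) :
    G'.Reachable (f a) (f b) := by
  obtain ⟨p⟩ := h
  induction p with
  | nil => rfl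
  | cons hadj _ ih => exact (hf _ _ hadj).trans ih

/-- A potential that grows by at most one along each edge bounds the distance from below. -/
theorem Connected.le_dist_of_forall_adj {G : SimpleGraph V} (hG : G.Connected) (φ : V → ℕ)
    (hφ : ∀ a b, G.Adj a b → φ b ≤ φ a + 1) (i j : V) : φ j ≤ φ i + G.dist i j := by
  obtain ⟨p, hp⟩ := hG.exists_walk_length_eq_dist i j
  rw [← hp]
  clear hp
  induction p with
  | nil => simp
  | cons hadj _ ih =>
    have := hφ _ _ hadj
    rw [Walk.length_cons]
    omega

/-- A map sending edges to edges or vertices does not increase distances. -/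
theorem Connected.dist_map_le {W : Type*} {G : SimpleGraph V} {G' : SimpleGraph W}
    (hG : G.Connected) (hG' : G'.Connected) (f : W → V)
    (hf : ∀ a b, G'.Adj a b → f a = f b ∨ G.Adj (f a) (f b)) (i j : W) :
    G.dist (f i) (f j) ≤ G'.dist i j := by
  have := hG'.le_dist_of_forall_adj (fun a => G.dist (f i) (f a)) (fun a b hab => by
    rcases hf a b hab with h | h
    · simp [h]
    · have := hG.dist_triangle (u := f i) (v := f a) (w := f b)
      rw [dist_eq_one_iff_adj.2 h] at this
      exact this) i j
  simpa using this

end Metric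

/-! ### Bridges and reattachment of branches. -/

/-- `B` is the side of `b` of a bridge `wb`: the edge `wb` is the only one leaving `B`. -/
structure IsBridgeSide (G : SimpleGraph V) (B : Set V) (w b : V) : Prop where
  adj : G.Adj w b
  mem : b ∈ B
  notMem : w ∉ B
  eq_of_adj : ∀ a ∈ B, ∀ c ∉ B, G.Adj a c → a = b ∧ c = w

theorem IsBridge.exists_isBridgeSide {G : SimpleGraph V} {w b : V} (h : G.IsBridge s(w, b))
    (hadj : G.Adj w b) : ∃ B, G.IsBridgeSide B w b := by
  rw [isBridge_iff] at h
  refine ⟨{a | (G.deleteEdges {s(w, b)}).Reachable a b}, hadj, Reachable.refl _, h, ?_⟩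
  intro a ha c hc hac
  by_cases he : s(a, c) = s(w, b)
  · rcases Sym2.eq_iff.1 he with ⟨rfl, rfl⟩ | ⟨rfl, rfl⟩
    · exact absurd ha h
    · exact ⟨rfl, rfl⟩
  · refine absurd (Reachable.trans (Adj.reachable ?_) ha) hc
    rw [deleteEdges_adj]
    exact ⟨hac.symm, by rwa [Set.mem_singleton_iff, Sym2.eq_swap]⟩

/-- A property that passes along edges holds everywhere in a connected graph. -/
theorem Preconnected.induction_adj {G : SimpleGraph V} (hG : G.Preconnected) {P : V → Prop} {a : V}
    (ha : P a) (hP : ∀ a c, G.Adj a c → P a → P c) (c : V) : P c := by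
  obtain ⟨p⟩ := hG a c
  induction p with
  | nil => exact ha
  | cons hadj _ ih => exact ih (hP _ _ hadj ha)

/-- `H` is connected and does not contain the only edge that enters `B`. -/
theorem IsBridgeSide.disjoint_verts {G : SimpleGraph V} {B : Set V} {w b : V}
    (hB : G.IsBridgeSide B w b) {H : G.Subgraph} (hH : H.Connected) (hw : w ∈ H.verts)
    (hwb : ¬ H.Adj w b) {a : V} (ha : a ∈ H.verts) : a ∉ B := by
  refine hH.preconnected.coe.induction_adj (P := fun a => (a : V) ∉ B) (a := ⟨w, hw⟩) hB.notMem ?_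
    ⟨a, ha⟩
  intro a c hac haB hcB
  obtain ⟨h1, h2⟩ := hB.eq_of_adj _ hcB _ haB (H.adj_sub hac).symm
  exact hwb (h1 ▸ h2 ▸ hac)

/-- No edge leaves `B ∩ C`: such an edge would put `v` into `B` or force `u = v`. By connectivity a
common vertex would then put `u` into `B`. -/
theorem IsBridgeSide.disjoint {G : SimpleGraph V} (hG : G.Connected) {B C : Set V} {u u' v v' : V}
    (hB : G.IsBridgeSide B u u') (hC : G.IsBridgeSide C v v') (hvB : v ∉ B) (huC : u ∉ C)
    (huv : u ≠ v) {a : V} (haB : a ∈ B) : a ∉ C := by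
  intro haC
  refine hB.notMem (hG.preconnected.induction_adj (P := fun a => a ∈ B ∧ a ∈ C) ⟨haB, haC⟩ ?_ u).1
  rintro a c hac ⟨h1, h2⟩
  by_contra hc
  by_cases hcB : c ∈ B
  · have hcC : c ∉ C := fun h => hc ⟨hcB, h⟩
    exact hvB ((hC.eq_of_adj a h2 c hcC hac).2 ▸ hcB)
  · have h := (hB.eq_of_adj a h1 c hcB hac).2
    subst h
    exact huv (hC.eq_of_adj a h2 c huC hac).2

/-- Reattaching one side of a bridge at another vertex of the other side. -/
theorem IsBridgeSide.exists_reattach {G : SimpleGraph V} (hG : G.Connected) {B : Set V} {w b : V}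
    (hB : G.IsBridgeSide B w b) {w' : V} (hw' : w' ∉ B) :
    ∃ G' : SimpleGraph V, G'.Connected ∧ (∀ k, 2 ≤ k → G.Colorable k → G'.Colorable k) ∧
      (∀ a c, G.Adj a c → s(a, c) ≠ s(w, b) → G'.Adj a c) ∧
      (∀ i j, (i ∈ B ↔ j ∈ B) → G.dist i j ≤ G'.dist i j) ∧
      (∀ i ∈ B, ∀ j ∉ B, G.dist i b + 1 + G.dist w' j ≤ G'.dist i j) := by
  classical
  have hbw' : b ≠ w' := fun h => hw' (h ▸ hB.mem)
  set G' : SimpleGraph V := G.deleteEdges {s(w, b)} ⊔ edge w' b with hG'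
  have hle : ∀ a c, G.Adj a c → s(a, c) ≠ s(w, b) → G'.Adj a c := fun a c h1 h2 => by
    rw [hG', sup_adj, deleteEdges_adj]
    exact Or.inl ⟨h1, h2⟩
  have hnew : G'.Adj b w' := by
    rw [hG', sup_adj, edge_adj]
    exact Or.inr ⟨Or.inr ⟨rfl, rfl⟩, hbw'⟩
  have hcase : ∀ a c, G'.Adj a c → (G.Adj a c ∧ (a ∈ B ↔ c ∈ B)) ∨ (a = w' ∧ c = b) ∨
      (a = b ∧ c = w') := by
    intro a c hac
    rw [hG', sup_adj, edge_adj, deleteEdges_adj] at hac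
    rcases hac with ⟨h1, h2⟩ | ⟨h, -⟩
    · refine Or.inl ⟨h1, ?_⟩
      by_contra hne
      by_cases ha : a ∈ B
      · obtain ⟨rfl, rfl⟩ := hB.eq_of_adj a ha c (by tauto) h1
        exact h2 (by simp [Sym2.eq_swap])
      · obtain ⟨rfl, rfl⟩ := hB.eq_of_adj c (by tauto) a ha h1.symm
        exact h2 (by simp)
    · exact Or.inr h
  have hside : ∀ a c, G.Adj a c → (a ∈ B ↔ c ∈ B) → G'.Adj a c := by
    intro a c h1 h2
    refine hle a c h1 fun h => ?_
    have := hB.mem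
    have := hB.notMem
    rcases Sym2.eq_iff.1 h with ⟨rfl, rfl⟩ | ⟨rfl, rfl⟩ <;> tauto
  have hcross : ∀ a c, G.Adj a c → ¬ (a ∈ B ↔ c ∈ B) → (a = b ∧ c = w) ∨ (a = w ∧ c = b) := by
    intro a c h1 h2
    by_cases ha : a ∈ B
    · exact Or.inl (hB.eq_of_adj a ha c (by tauto) h1)
    · exact Or.inr (hB.eq_of_adj c (by tauto) a ha h1.symm).symm
  have hbB := hB.mem
  have hwB := hB.notMem
  have hconn : G'.Connected := by
    -- Folding the complement of `B` onto `w'` turns the old bridge into the new one; `h2` folds `B`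
    -- onto `w` instead.
    have h1 : ∀ a ∈ B, G'.Reachable a b := fun a ha => by
      have := (hG.preconnected a b).of_forall_adj (G' := G')
        (fun a => if a ∈ B then a else w') (fun a c hac => by
          by_cases h : a ∈ B ↔ c ∈ B
          · by_cases ha : a ∈ B
            · simpa [ha, h.1 ha] using (hside a c hac h).reachable
            · have hc : c ∉ B := by tauto
              simp [ha, hc]
          · rcases hcross a c hac h with ⟨rfl, rfl⟩ | ⟨rfl, rfl⟩
            · simpa [hbB, hwB] using hnew.reachable
            · simpa [hbB, hwB] using hnew.symm.reachable)
      simpa [ha, hbB] using this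
    have h2 : ∀ a ∉ B, G'.Reachable a w' := fun a ha => by
      have := (hG.preconnected a w').of_forall_adj (G' := G')
        (fun a => if a ∈ B then w else a) (fun a c hac => by
          by_cases h : a ∈ B ↔ c ∈ B
          · by_cases ha : a ∈ B
            · simp [ha, h.1 ha]
            · have hc : c ∉ B := by tauto
              simpa [ha, hc] using (hside a c hac h).reachable
          · rcases hcross a c hac h with ⟨rfl, rfl⟩ | ⟨rfl, rfl⟩ <;> simp [hbB, hwB])
      simpa [ha, hw'] using this
    refine (connected_iff_exists_forall_reachable _).2 ⟨w', fun a => ?_⟩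
    by_cases ha : a ∈ B
    · exact ((h1 a ha).trans hnew.reachable).symm
    · exact (h2 a ha).symm
  refine ⟨G', hconn, ?_, hle, ?_, ?_⟩
  · rintro k hk ⟨c⟩
    have : Nontrivial (Fin k) := Fin.nontrivial_iff_two_le.2 hk
    obtain ⟨γ, hγ⟩ := exists_ne (c w')
    -- Permuting the colours on `B` gives `b` a colour `γ` different from that of `w'`.
    refine ⟨Coloring.mk (fun a => if a ∈ B then Equiv.swap (c b) γ (c a) else c a) ?_⟩
    intro a d had
    rcases hcase a d had with ⟨h1, h2⟩ | ⟨rfl, rfl⟩ | ⟨rfl, rfl⟩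
    · have := c.valid h1
      by_cases ha : a ∈ B
      · simpa [ha, h2.1 ha] using this
      · have hd : d ∉ B := by tauto
        simpa [ha, hd] using this
    · simpa [hbB, hw'] using hγ.symm
    · simpa [hbB, hw'] using hγ
  · intro i j hij
    by_cases hi : i ∈ B
    · have := hG.dist_map_le hconn (fun a => if a ∈ B then a else w) (fun a c hac => by
        rcases hcase a c hac with ⟨h1, h2⟩ | ⟨rfl, rfl⟩ | ⟨rfl, rfl⟩
        · by_cases ha : a ∈ B
          · simp [ha, h2.1 ha, h1]
          · have hc : c ∉ B := by tauto
            simp [ha, hc]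
        · simp [hbB, hw', hB.adj]
        · simp [hbB, hw', hB.adj.symm]) i j
      simpa [hi, hij.1 hi] using this
    · have hj : j ∉ B := by tauto
      have := hG.dist_map_le hconn (fun a => if a ∈ B then w' else a) (fun a c hac => by
        rcases hcase a c hac with ⟨h1, h2⟩ | ⟨rfl, rfl⟩ | ⟨rfl, rfl⟩
        · by_cases ha : a ∈ B
          · simp [ha, h2.1 ha]
          · have hc : c ∉ B := by tauto
            simp [ha, hc, h1]
        · simp [hbB, hw']
        · simp [hbB, hw']) i j
      simpa [hi, hj] using this
  · intro i hi j hj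
    have := hconn.le_dist_of_forall_adj
      (fun a => if a ∈ B then G.dist i a else G.dist i b + 1 + G.dist w' a) (fun a c hac => by
        rcases hcase a c hac with ⟨h1, h2⟩ | ⟨rfl, rfl⟩ | ⟨rfl, rfl⟩
        · have h3 := dist_eq_one_iff_adj.2 h1
          by_cases ha : a ∈ B
          · have := hG.dist_triangle (u := i) (v := a) (w := c)
            simp only [ha, h2.1 ha, if_true]
            omega
          · have hc : c ∉ B := by tauto
            have := hG.dist_triangle (u := w') (v := a) (w := c)
            simp only [ha, hc, if_false]
            omega
        · simp [hbB, hw']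
          omega
        · simp [hbB, hw']) i j
    simpa [hi, hj] using this

/-! ### Sliding the graph along an edge with branches at both ends. -/

/-- The vertices outside two branches `B`, `C` and different from their attachment vertices. -/
def branchCore (B C : Set V) (u v : V) : Set V := {z | z ∉ B ∧ z ∉ C ∧ z ≠ u ∧ z ≠ v}

theorem branchCore_comm (B C : Set V) (u v : V) : branchCore B C u v = branchCore C B v u := by
  ext z
  simp only [branchCore, Set.mem_ofPred_eq]
  tauto

open Classical in
/-- Shift by one step along the path `v, u, u'`. -/
noncomputable def shiftAlong (u u' v p : V) : V := if p = u then u' else if p = v then u else p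

/-- Let `uv` be an edge with branches `B`, `C` hanging by bridges at `u` and `v`. The rest
of the graph is slid along the path `v, u, u'` by one step, towards the branch `B`. -/
def slide (G : SimpleGraph V) (B C : Set V) (u u' v : V) : SimpleGraph V :=
  -- The first clause is the shifted copy of the graph without its branches, in which `uv` lands on
  -- `u'u`. The second keeps the branches, their bridges and `uv`; thus `v` joins the branch `C`,
  -- now hanging at `u`, while `u'` takes over the role of `u`.
  fromRel fun a c =>
    (∃ p q, p ∉ B ∧ p ∉ C ∧ q ∉ B ∧ q ∉ C ∧ G.Adj p q ∧ shiftAlong u u' v p = a ∧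
      shiftAlong u u' v q = c) ∨
    (G.Adj a c ∧ a ∉ branchCore B C u v ∧ c ∉ branchCore B C u v)

/-- Two branches hanging by bridges `uu'` and `vv'` at the ends of an edge `uv`. -/
structure IsBranchPair (G : SimpleGraph V) (B C : Set V) (u u' v v' : V) : Prop where
  connected : G.Connected
  left : G.IsBridgeSide B u u'
  right : G.IsBridgeSide C v v'
  adj : G.Adj u v
  right_notMem : v ∉ B
  left_notMem : u ∉ C

namespace IsBranchPair

variable {G : SimpleGraph V} {B C : Set V} {u u' v v' : V}

theorem symm (h : G.IsBranchPair B C u u' v v') : G.IsBranchPair C B v v' u u' :=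
  ⟨h.connected, h.right, h.left, h.adj.symm, h.left_notMem, h.right_notMem⟩

theorem notMem_of_mem (h : G.IsBranchPair B C u u' v v') {a : V} (ha : a ∈ B) : a ∉ C :=
  h.left.disjoint h.connected h.right h.right_notMem h.left_notMem h.adj.ne ha

theorem notMem_of_mem_or (h : G.IsBranchPair B C u u' v v') {a : V} (ha : a ∈ C ∨ a = v) :
    a ∉ B := by
  rcases ha with ha | rfl
  · exact h.symm.notMem_of_mem ha
  · exact h.right_notMem

theorem adj_cases (h : G.IsBranchPair B C u u' v v') {a c : V} (hac : G.Adj a c) :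
    (a ∈ B ∧ c ∈ B) ∨ (a ∈ C ∧ c ∈ C) ∨ (a = u' ∧ c = u) ∨ (a = u ∧ c = u') ∨
      (a = v' ∧ c = v) ∨ (a = v ∧ c = v') ∨ (a ∉ B ∧ a ∉ C ∧ c ∉ B ∧ c ∉ C) := by
  by_cases ha : a ∈ B
  · by_cases hc : c ∈ B
    · exact Or.inl ⟨ha, hc⟩
    · exact Or.inr (Or.inr (Or.inl (h.left.eq_of_adj a ha c hc hac)))
  by_cases hc : c ∈ B
  · exact Or.inr (Or.inr (Or.inr (Or.inl (h.left.eq_of_adj c hc a ha hac.symm).symm)))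
  by_cases ha' : a ∈ C
  · by_cases hc' : c ∈ C
    · exact Or.inr (Or.inl ⟨ha', hc'⟩)
    · exact Or.inr (Or.inr (Or.inr (Or.inr (Or.inl (h.right.eq_of_adj a ha' c hc' hac)))))
  by_cases hc' : c ∈ C
  · exact Or.inr (Or.inr (Or.inr (Or.inr (Or.inr (Or.inl
      (h.right.eq_of_adj c hc' a ha' hac.symm).symm)))))
  · exact Or.inr (Or.inr (Or.inr (Or.inr (Or.inr (Or.inr ⟨ha, ha', hc, hc'⟩)))))

theorem eq_or_eq_of_adj_core (h : G.IsBranchPair B C u u' v v') {a c : V}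
    (ha : a ∉ branchCore B C u v) (hc : c ∈ branchCore B C u v) (hac : G.Adj a c) :
    a = u ∨ a = v := by
  by_contra hne
  rw [not_or] at hne
  by_cases haB : a ∈ B
  · exact hc.2.2.1 (h.left.eq_of_adj a haB c hc.1 hac).2
  by_cases haC : a ∈ C
  · exact hc.2.2.2 (h.right.eq_of_adj a haC c hc.2.1 hac).2
  · exact ha ⟨haB, haC, hne.1, hne.2⟩

theorem u_notMem_core : u ∉ branchCore B C u v := fun h => h.2.2.1 rfl

theorem v_notMem_core : v ∉ branchCore B C u v := fun h => h.2.2.2 rfl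

theorem left_notMem_core {a : V} (ha : a ∈ B) : a ∉ branchCore B C u v := fun h => h.1 ha

theorem right_notMem_core {a : V} (ha : a ∈ C ∨ a = v) : a ∉ branchCore B C u v :=
  fun h => ha.elim h.2.1 h.2.2.2

theorem shiftAlong_left : shiftAlong u u' v u = u' := by simp [shiftAlong]

theorem shiftAlong_right (h : u ≠ v) : shiftAlong u u' v v = u := by simp [shiftAlong, h.symm]

theorem shiftAlong_core {z : V} (h1 : z ≠ u) (h2 : z ≠ v) : shiftAlong u u' v z = z := by
  simp [shiftAlong, h1, h2]

theorem slide_adj_shiftAlong (h : G.IsBranchPair B C u u' v v') {a c : V} (ha : a ∉ B)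
    (ha' : a ∉ C) (hc : c ∉ B) (hc' : c ∉ C) (hac : G.Adj a c) :
    (G.slide B C u u' v).Adj (shiftAlong u u' v a) (shiftAlong u u' v c) := by
  refine ⟨fun heq => ?_, Or.inl (Or.inl ⟨a, c, ha, ha', hc, hc', hac, rfl, rfl⟩)⟩
  have h1 := hac.ne
  have h2 := h.left.mem
  have h3 := h.left.notMem
  simp only [shiftAlong] at heq
  grind

theorem slide_adj_of_notMem {a c : V} (ha : a ∉ branchCore B C u v)
    (hc : c ∉ branchCore B C u v) (hac : G.Adj a c) : (G.slide B C u u' v).Adj a c :=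
  ⟨hac.ne, Or.inl (Or.inr ⟨hac, ha, hc⟩)⟩

/-- Case analysis on the edges of the slid graph, up to orientation. -/
theorem slide_adj_induction (h : G.IsBranchPair B C u u' v v') {P : V → V → Prop}
    (hsymm : ∀ a c, P a c → P c a)
    (core : ∀ a c, a ∈ branchCore B C u v → c ∈ branchCore B C u v → G.Adj a c → P a c)
    (core_right : ∀ a, a ∈ branchCore B C u v → G.Adj a v → P a u)
    (core_left : ∀ a, a ∈ branchCore B C u v → G.Adj a u → P a u')
    (bridge : P u' u) (middle : P u v) (left : ∀ a c, a ∈ B → c ∈ B → G.Adj a c → P a c)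
    (right : ∀ a c, (a ∈ C ∨ a = v) → (c ∈ C ∨ c = v) → G.Adj a c → P a c)
    (a c : V) (hac : (G.slide B C u u' v).Adj a c) : P a c := by
  have main : ∀ a c, ((∃ p q, p ∉ B ∧ p ∉ C ∧ q ∉ B ∧ q ∉ C ∧ G.Adj p q ∧
      shiftAlong u u' v p = a ∧ shiftAlong u u' v q = c) ∨
      (G.Adj a c ∧ a ∉ branchCore B C u v ∧ c ∉ branchCore B C u v)) → P a c := by
    clear hac a c
    rintro a c (⟨p, q, hp1, hp2, hq1, hq2, hpq, rfl, rfl⟩ | ⟨hac, ha, hc⟩)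
    · by_cases hpu : p = u
      · subst hpu
        by_cases hqv : q = v
        · subst hqv
          rwa [shiftAlong_left, shiftAlong_right hpq.ne]
        · rw [shiftAlong_left, shiftAlong_core hpq.ne' hqv]
          exact hsymm _ _ (core_left q ⟨hq1, hq2, hpq.ne', hqv⟩ hpq.symm)
      · by_cases hpv : p = v
        · subst hpv
          rw [shiftAlong_right h.adj.ne]
          by_cases hqu : q = u
          · subst hqu
            rw [shiftAlong_left]
            exact hsymm _ _ bridge
          · rw [shiftAlong_core hqu hpq.ne']
            exact hsymm _ _ (core_right q ⟨hq1, hq2, hqu, hpq.ne'⟩ hpq.symm)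
        · rw [shiftAlong_core hpu hpv]
          by_cases hqu : q = u
          · subst hqu
            rw [shiftAlong_left]
            exact core_left p ⟨hp1, hp2, hpu, hpv⟩ hpq
          · by_cases hqv : q = v
            · subst hqv
              rw [shiftAlong_right h.adj.ne]
              exact core_right p ⟨hp1, hp2, hpu, hpv⟩ hpq
            · rw [shiftAlong_core hqu hqv]
              exact core p q ⟨hp1, hp2, hpu, hpv⟩ ⟨hq1, hq2, hqu, hqv⟩ hpq
    · rcases h.adj_cases hac with h' | h' | ⟨rfl, rfl⟩ | ⟨rfl, rfl⟩ | ⟨rfl, rfl⟩ | ⟨rfl, rfl⟩ | h'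
      · exact left a c h'.1 h'.2 hac
      · exact right a c (Or.inl h'.1) (Or.inl h'.2) hac
      · exact bridge
      · exact hsymm _ _ bridge
      · exact right _ _ (Or.inl h.right.mem) (Or.inr rfl) hac
      · exact right _ _ (Or.inr rfl) (Or.inl h.right.mem) hac
      · have ha' : a = u ∨ a = v := by
          by_contra hne
          rw [not_or] at hne
          exact ha ⟨h'.1, h'.2.1, hne⟩
        have hc' : c = u ∨ c = v := by
          by_contra hne
          rw [not_or] at hne
          exact hc ⟨h'.2.2.1, h'.2.2.2, hne⟩
        rcases ha' with rfl | rfl <;> rcases hc' with rfl | rfl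
        · exact absurd rfl hac.ne
        · exact middle
        · exact hsymm _ _ middle
        · exact absurd rfl hac.ne
  obtain ⟨-, h' | h'⟩ := hac
  · exact main a c h'
  · exact hsymm _ _ (main c a h')

/-- Collapsing the core to `u` links everything outside the core to `u`. Collapsing the branches to
`u` and `v` and then shifting links the core to `u'`. -/
theorem slide_connected (h : G.IsBranchPair B C u u' v v') : (G.slide B C u u' v).Connected := by
  classical
  have hnuv : (G.slide B C u u' v).Adj u v :=
    slide_adj_of_notMem u_notMem_core v_notMem_core h.adj
  have hnuu' : (G.slide B C u u' v).Adj u u' :=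
    slide_adj_of_notMem u_notMem_core (left_notMem_core h.left.mem) h.left.adj
  have h1 : ∀ a, a ∉ branchCore B C u v → (G.slide B C u u' v).Reachable a u := fun a ha => by
    have := (h.connected.preconnected a u).of_forall_adj (G' := G.slide B C u u' v)
      (fun a => if a ∈ branchCore B C u v then u else a) (fun a c hac => by
        by_cases ha : a ∈ branchCore B C u v <;> by_cases hc : c ∈ branchCore B C u v
        · rw [if_pos ha, if_pos hc]
        · rw [if_pos ha, if_neg hc]
          rcases h.eq_or_eq_of_adj_core hc ha hac.symm with rfl | rfl
          · rfl
          · exact hnuv.reachable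
        · rw [if_neg ha, if_pos hc]
          rcases h.eq_or_eq_of_adj_core ha hc hac with rfl | rfl
          · rfl
          · exact hnuv.symm.reachable
        · rw [if_neg ha, if_neg hc]
          exact (slide_adj_of_notMem ha hc hac).reachable)
    rwa [if_neg ha, if_neg u_notMem_core] at this
  have h2 : ∀ a, a ∈ branchCore B C u v → (G.slide B C u u' v).Reachable a u' := fun a ha => by
    have := (h.connected.preconnected a u).of_forall_adj (G' := G.slide B C u u' v)
      (fun a => shiftAlong u u' v (if a ∈ B then u else if a ∈ C then v else a))
      (fun a c hac => by
        have e1 := h.left.mem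
        have e2 := h.left.notMem
        have e3 := h.right.mem
        have e4 := h.right.notMem
        have e5 := h.left_notMem
        have e6 := h.right_notMem
        rcases h.adj_cases hac with
          h' | h' | ⟨rfl, rfl⟩ | ⟨rfl, rfl⟩ | ⟨rfl, rfl⟩ | ⟨rfl, rfl⟩ | h'
        · rw [if_pos h'.1, if_pos h'.2]
        · rw [if_neg (h.symm.notMem_of_mem h'.1), if_neg (h.symm.notMem_of_mem h'.2), if_pos h'.1,
            if_pos h'.2]
        · rw [if_pos e1, if_neg e2, if_neg e5]
        · rw [if_pos e1, if_neg e2, if_neg e5]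
        · rw [if_neg (h.symm.notMem_of_mem e3), if_pos e3, if_neg e6, if_neg e4]
        · rw [if_neg (h.symm.notMem_of_mem e3), if_pos e3, if_neg e6, if_neg e4]
        · rw [if_neg h'.1, if_neg h'.2.1, if_neg h'.2.2.1, if_neg h'.2.2.2]
          exact (h.slide_adj_shiftAlong h'.1 h'.2.1 h'.2.2.1 h'.2.2.2 hac).reachable)
    rwa [if_neg ha.1, if_neg ha.2.1, shiftAlong_core ha.2.2.1 ha.2.2.2, if_neg h.left.notMem,
      if_neg h.left_notMem, shiftAlong_left] at this
  refine (connected_iff_exists_forall_reachable _).2 ⟨u, fun a => ?_⟩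
  by_cases ha : a ∈ branchCore B C u v
  · exact ((h2 a ha).trans hnuu'.symm.reachable).symm
  · exact (h1 a ha).symm

/-- The shift forces the colours of `u` and `v` onto `u'` and `u`; a transposition of colours on `B`
and another on `C ∪ {v}` restore properness. -/
theorem slide_colorable (h : G.IsBranchPair B C u u' v v') {k : ℕ} (hk : G.Colorable k) :
    (G.slide B C u u' v).Colorable k := by
  classical
  obtain ⟨c⟩ := hk
  set f : V → Fin k := fun a => if a ∈ B then Equiv.swap (c u') (c u) (c a) else
      if a ∈ C ∨ a = v then Equiv.swap (c u) (c v) (c a) else if a = u then c v else c a with hf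
  have fB : ∀ a ∈ B, f a = Equiv.swap (c u') (c u) (c a) := fun a ha => by simp only [hf, if_pos ha]
  have fC : ∀ a, a ∈ C ∨ a = v → f a = Equiv.swap (c u) (c v) (c a) := fun a ha => by
    simp only [hf, if_neg (h.notMem_of_mem_or ha), if_pos ha]
  have fu : f u = c v := by
    simp [hf, h.left.notMem, h.left_notMem, h.adj.ne]
  have fz : ∀ a ∈ branchCore B C u v, f a = c a := fun a ha => by
    simp [hf, ha.1, ha.2.1, ha.2.2.1, ha.2.2.2]
  have fu' : f u' = c u := by rw [fB u' h.left.mem, Equiv.swap_apply_left]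
  have fv : f v = c u := by rw [fC v (Or.inr rfl), Equiv.swap_apply_right]
  refine ⟨Coloring.mk f fun {a d} had => ?_⟩
  refine h.slide_adj_induction (P := fun a d => f a ≠ f d) (fun a d h => h.symm)
    ?_ ?_ ?_ ?_ ?_ ?_ ?_ a d had
  · intro a d ha hd had
    rw [fz a ha, fz d hd]
    exact c.valid had
  · intro a ha had
    rw [fz a ha, fu]
    exact c.valid had
  · intro a ha had
    rw [fz a ha, fu']
    exact c.valid had
  · rw [fu', fu]
    exact c.valid h.adj
  · rw [fu, fv]
    exact c.valid h.adj.symm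
  · intro a d ha hd had
    rw [fB a ha, fB d hd]
    exact (Equiv.injective _).ne (c.valid had)
  · intro a d ha hd had
    rw [fC a ha, fC d hd]
    exact (Equiv.injective _).ne (c.valid had)

/-- Contracting the core to `u` maps the slid graph back into `G` and fixes all other vertices. -/
theorem dist_le_slide_dist_of_notMem (h : G.IsBranchPair B C u u' v v') {i j : V}
    (hi : i ∉ branchCore B C u v) (hj : j ∉ branchCore B C u v) :
    G.dist i j ≤ (G.slide B C u u' v).dist i j := by
  classical
  have hu : u ∉ branchCore B C u v := u_notMem_core
  have hu' : u' ∉ branchCore B C u v := left_notMem_core h.left.mem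
  have := h.connected.dist_map_le h.slide_connected
    (fun a => if a ∈ branchCore B C u v then u else a) (by
      refine h.slide_adj_induction ?_ ?_ ?_ ?_ ?_ ?_ ?_ ?_
      · rintro a c (h | h)
        · exact Or.inl h.symm
        · exact Or.inr h.symm
      · intro a c ha hc _
        rw [if_pos ha, if_pos hc]
        exact Or.inl rfl
      · intro a ha _
        rw [if_pos ha, if_neg hu]
        exact Or.inl rfl
      · intro a ha _
        rw [if_pos ha, if_neg hu']
        exact Or.inr h.left.adj
      · rw [if_neg hu, if_neg hu']
        exact Or.inr h.left.adj.symm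
      · rw [if_neg hu, if_neg v_notMem_core]
        exact Or.inr h.adj
      · intro a c ha hc hac
        rw [if_neg (left_notMem_core ha), if_neg (left_notMem_core hc)]
        exact Or.inr hac
      · intro a c ha hc hac
        rw [if_neg (right_notMem_core ha), if_neg (right_notMem_core hc)]
        exact Or.inr hac) i j
  rwa [if_neg hi, if_neg hj] at this

/-- Seen from the core, `B` comes closer by at most one and `C ∪ {v}` recedes by at least one. In
the opposite slide the roles are exchanged, which is why the average loses nothing. -/
theorem slide_dist_core (h : G.IsBranchPair B C u u' v v') {z : V}
    (hz : z ∈ branchCore B C u v) :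
    (∀ a ∈ branchCore B C u v, G.dist z a ≤ (G.slide B C u u' v).dist z a) ∧
    (∀ a ∈ B, G.dist z a ≤ (G.slide B C u u' v).dist z a + 1) ∧
    (∀ a, a ∈ C ∨ a = v → G.dist z a + 1 ≤ (G.slide B C u u' v).dist z a) ∧
    G.dist z v ≤ (G.slide B C u u' v).dist z u := by
  classical
  -- `φ` is the expected distance from `z` after sliding: `B` is entered through `u'` in the role of
  -- `u`, and `C ∪ {v}` through `u` in the role of `v`.
  set φ : V → ℕ := fun a => if a ∈ B then G.dist z u + G.dist u' a else
    if a ∈ C ∨ a = v then G.dist z v + 1 + G.dist v a else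
    if a = u then G.dist z v else G.dist z a with hφ
  have hφB : ∀ a ∈ B, φ a = G.dist z u + G.dist u' a := fun a ha => by simp only [hφ, if_pos ha]
  have hφC : ∀ a, a ∈ C ∨ a = v → φ a = G.dist z v + 1 + G.dist v a := fun a ha => by
    simp only [hφ, if_neg (h.notMem_of_mem_or ha), if_pos ha]
  have hφu : φ u = G.dist z v := by simp [hφ, h.left.notMem, h.left_notMem, h.adj.ne]
  have hφz : ∀ a ∈ branchCore B C u v, φ a = G.dist z a := fun a ha => by
    simp [hφ, ha.1, ha.2.1, ha.2.2.1, ha.2.2.2]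
  have hstep : ∀ x a c, G.Adj a c → G.dist x c ≤ G.dist x a + 1 := fun x a c hac => by
    have := h.connected.dist_triangle (u := x) (v := a) (w := c)
    rwa [dist_eq_one_iff_adj.2 hac] at this
  have hlip : ∀ a c, (G.slide B C u u' v).Adj a c → φ c ≤ φ a + 1 ∧ φ a ≤ φ c + 1 := by
    refine h.slide_adj_induction (fun a c h => h.symm) ?_ ?_ ?_ ?_ ?_ ?_ ?_
    · intro a c ha hc hac
      rw [hφz a ha, hφz c hc]
      exact ⟨hstep _ _ _ hac, hstep _ _ _ hac.symm⟩
    · intro a ha hav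
      rw [hφz a ha, hφu]
      exact ⟨hstep _ _ _ hav, hstep _ _ _ hav.symm⟩
    · intro a ha hau
      rw [hφz a ha, hφB u' h.left.mem, dist_self, add_zero]
      exact ⟨hstep _ _ _ hau, hstep _ _ _ hau.symm⟩
    · rw [hφu, hφB u' h.left.mem, dist_self, add_zero]
      exact ⟨hstep _ _ _ h.adj, hstep _ _ _ h.adj.symm⟩
    · rw [hφu, hφC v (Or.inr rfl), dist_self]
      omega
    · intro a c ha hc hac
      rw [hφB a ha, hφB c hc]
      have := hstep u' _ _ hac
      have := hstep u' _ _ hac.symm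
      omega
    · intro a c ha hc hac
      rw [hφC a ha, hφC c hc]
      have := hstep v _ _ hac
      have := hstep v _ _ hac.symm
      omega
  have hle : ∀ a, φ a ≤ (G.slide B C u u' v).dist z a := fun a => by
    have := h.slide_connected.le_dist_of_forall_adj φ (fun a c h => (hlip a c h).1) z a
    rwa [hφz z hz, dist_self, zero_add] at this
  refine ⟨fun a ha => hφz a ha ▸ hle a, fun a ha => ?_, fun a ha => ?_, hφu ▸ hle u⟩
  · have h1 := hle a
    rw [hφB a ha] at h1
    have h2 := h.connected.dist_triangle (u := z) (v := u) (w := a)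
    have h3 := h.connected.dist_triangle (u := u) (v := u') (w := a)
    rw [dist_eq_one_iff_adj.2 h.left.adj] at h3
    omega
  · have h1 := hle a
    rw [hφC a ha] at h1
    have h2 := h.connected.dist_triangle (u := z) (v := v) (w := a)
    omega

/-- The average of the two slides does not decrease the distances to the core. -/
theorem two_mul_dist_core_le (h : G.IsBranchPair B C u u' v v') {z : V}
    (hz : z ∈ branchCore B C u v) (a : V) :
    2 * G.dist z a ≤ (G.slide B C u u' v).dist z a + (G.slide C B v v' u).dist z a := by
  obtain ⟨h1, h2, h3, h4⟩ := h.slide_dist_core hz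
  have hz' := hz
  rw [branchCore_comm] at hz'
  obtain ⟨k1, k2, k3, k4⟩ := h.symm.slide_dist_core hz'
  have hstep : ∀ a c, G.Adj a c → G.dist z c ≤ G.dist z a + 1 := fun a c hac => by
    have := h.connected.dist_triangle (u := z) (v := a) (w := c)
    rwa [dist_eq_one_iff_adj.2 hac] at this
  have e1 := hstep _ _ h.adj
  have e2 := hstep _ _ h.adj.symm
  by_cases ha : a ∈ branchCore B C u v
  · have := h1 a ha
    rw [branchCore_comm] at ha
    have := k1 a ha
    omega
  by_cases haB : a ∈ B
  · have := h2 a haB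
    have := k3 a (Or.inl haB)
    omega
  by_cases haC : a ∈ C
  · have := h3 a (Or.inl haC)
    have := k2 a haC
    omega
  by_cases hau : a = u
  · subst hau
    have := k3 a (Or.inr rfl)
    omega
  by_cases hav : a = v
  · subst hav
    have := h3 a (Or.inr rfl)
    omega
  · exact absurd ⟨haB, haC, hau, hav⟩ ha

theorem two_mul_dist_le (h : G.IsBranchPair B C u u' v v') (i j : V) :
    2 * G.dist i j ≤ (G.slide B C u u' v).dist i j + (G.slide C B v v' u).dist i j := by
  by_cases hi : i ∈ branchCore B C u v
  · exact h.two_mul_dist_core_le hi j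
  by_cases hj : j ∈ branchCore B C u v
  · have := h.two_mul_dist_core_le hj i
    rwa [G.dist_comm, dist_comm (G := slide _ _ _ _ _ _),
      dist_comm (G := slide _ C B _ _ _)] at this
  · have h1 := h.dist_le_slide_dist_of_notMem hi hj
    rw [branchCore_comm] at hi hj
    have h2 := h.symm.dist_le_slide_dist_of_notMem hi hj
    omega

/-- For a vertex of the core, the average of the two slides increases the sum of the distances
to the ends of the middle edge. -/
theorem two_mul_dist_add_dist_lt (h : G.IsBranchPair B C u u' v v') {z : V}
    (hz : z ∈ branchCore B C u v) :
    2 * G.dist z u + 2 * G.dist z v <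
      ((G.slide B C u u' v).dist z u + (G.slide C B v v' u).dist z u) +
      ((G.slide B C u u' v).dist z v + (G.slide C B v v' u).dist z v) := by
  obtain ⟨-, -, h3, h4⟩ := h.slide_dist_core hz
  rw [branchCore_comm] at hz
  obtain ⟨-, -, k3, k4⟩ := h.symm.slide_dist_core hz
  have := h3 v (Or.inr rfl)
  have := k3 u (Or.inr rfl)
  omega

end IsBranchPair

/-! ### Critical subgraphs. -/

section Critical

theorem Subgraph.exists_isCritical_le [Finite V] {G : SimpleGraph V} {k : ℕ} (H₀ : G.Subgraph)
    (h₀ : H₀.coe.chromaticNumber = k) : ∃ H ≤ H₀, H.coe.IsCritical k := by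
  obtain ⟨H, ⟨hle, hk⟩, hmin⟩ := Set.Finite.exists_minimal
    (Set.toFinite {H : G.Subgraph | H ≤ H₀ ∧ (k : ℕ∞) ≤ H.coe.chromaticNumber})
    ⟨H₀, le_rfl, h₀.ge⟩
  refine ⟨H, hle, le_antisymm ?_ hk, fun K hK => ?_⟩
  · rw [← h₀]
    exact chromaticNumber_mono_of_hom (Subgraph.inclusion hle)
  · by_contra hlt
    rw [not_lt] at hlt
    -- A subgraph `K` of `H` is transported to a subgraph of `G` below `H`, where minimality
    -- applies.
    let f : K.coe →g (Subgraph.coeSubgraph K).coe :=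
      { toFun := fun a => ⟨a.1.1, a.1, a.2, rfl⟩
        map_rel' := fun {a b} hab => ⟨a.1, b.1, hab, rfl, rfl⟩ }
    have hKH := Subgraph.coeSubgraph_le K
    have hHK := hmin ⟨hKH.trans hle, hlt.trans (chromaticNumber_mono_of_hom f)⟩ hKH
    refine hK (top_le_iff.1 ⟨fun a _ => ?_, fun a b hab => ?_⟩)
    · obtain ⟨x, hx, hxa⟩ := hHK.1 a.2
      rwa [← Subtype.ext hxa]
    · obtain ⟨x, y, hxy, hxa, hyb⟩ := hHK.2 hab
      rwa [← Subtype.ext (a1 := x) (a2 := a) hxa, ← Subtype.ext (a1 := y) (a2 := b) hyb]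

/-- Otherwise every component is a proper subgraph, hence `(k - 1)`-colourable, and so is the whole
graph. -/
theorem IsCritical.connected {G : SimpleGraph V} {k : ℕ} (hk : k ≠ 0) (hG : G.IsCritical k) :
    G.Connected := by
  have hne : Nonempty V := by
    by_contra h
    rw [not_nonempty_iff, ← chromaticNumber_eq_zero_iff, hG.1] at h
    exact hk (by exact_mod_cast h)
  refine ⟨?_⟩
  by_contra hpre
  have hcol : G.Colorable (k - 1) := by
    rw [colorable_iff_forall_connectedComponent]
    intro c
    have hc : c.toSubgraph ≠ ⊤ := by
      intro h
      have := c.connected_toSubgraph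
      rw [h] at this
      apply hpre
      intro a b
      have := this.preconnected.coe ⟨a, trivial⟩ ⟨b, trivial⟩
      exact this.map (Subgraph.hom _)
    have hlt := hG.2 _ hc
    have hle : c.toSubgraph.coe.chromaticNumber ≤ ((k - 1 : ℕ) : ℕ∞) := by
      obtain ⟨m, rfl⟩ := Nat.exists_eq_succ_of_ne_zero hk
      simpa [ENat.lt_add_one_iff] using hlt
    rwa [chromaticNumber_le_iff_colorable, c.coe_toSubgraph] at hle
  have := hcol.chromaticNumber_le
  rw [hG.1] at this
  have : k ≤ k - 1 := by exact_mod_cast this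
  omega

end Critical

/-- Every walk into `B` passes through `w`; the potential measures the route through `w`. -/
theorem IsBridgeSide.dist_add_dist_le {G : SimpleGraph V} (hG : G.Connected) {B : Set V} {w b : V}
    (hB : G.IsBridgeSide B w b) {i j : V} (hi : i ∉ B) (hj : j ∈ B) :
    G.dist i w + G.dist w j ≤ G.dist i j := by
  classical
  have hstep : ∀ x a c, G.Adj a c → G.dist x c ≤ G.dist x a + 1 := fun x a c hac => by
    have := hG.dist_triangle (u := x) (v := a) (w := c)
    rwa [dist_eq_one_iff_adj.2 hac] at this
  have h1 := dist_eq_one_iff_adj.2 hB.adj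
  have := hG.le_dist_of_forall_adj
    (fun a => if a ∈ B then G.dist i w + G.dist w a else G.dist i a) (fun a c hac => by
      by_cases ha : a ∈ B <;> by_cases hc : c ∈ B
      · simp only [if_pos ha, if_pos hc]
        have := hstep w a c hac
        omega
      · obtain ⟨rfl, rfl⟩ := hB.eq_of_adj a ha c hc hac
        simp only [if_pos ha, if_neg hc]
        omega
      · obtain ⟨rfl, rfl⟩ := hB.eq_of_adj c hc a ha hac.symm
        simp only [if_pos hc, if_neg ha]
        omega
      · simp only [if_neg ha, if_neg hc]
        exact hstep i a c hac) i j
  simpa [hi, hj] using this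

/-- At an end of a bridge, the distance to a fixed vertex is at most the average of the distances
from the other end and from a further neighbour. -/
theorem IsBridgeSide.two_mul_dist_le {G : SimpleGraph V} (hG : G.Connected) {B : Set V} {w b : V}
    (hB : G.IsBridgeSide B w b) {c : V} (hc : G.Adj w c) (hcb : c ≠ b) (j : V) :
    2 * G.dist w j ≤ G.dist b j + G.dist c j := by
  have hcB : c ∉ B := fun h => hcb (hB.eq_of_adj c h w hB.notMem hc.symm).1
  have h1 := dist_eq_one_iff_adj.2 hB.adj
  have h2 := dist_eq_one_iff_adj.2 hc
  by_cases hj : j ∈ B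
  · have h3 := hB.dist_add_dist_le hG hcB hj
    have h4 := hG.dist_triangle (u := w) (v := b) (w := j)
    rw [G.dist_comm (u := c) (v := w)] at h3
    omega
  · have h3 := hB.dist_add_dist_le hG hj hB.mem
    have h4 := hG.dist_triangle (u := w) (v := c) (w := j)
    rw [G.dist_comm (u := j) (v := b), G.dist_comm (u := j) (v := w)] at h3
    omega

/-! ### Forbidden configurations in a maximizer. -/

section Maximal

variable [Fintype V] {k n : ℕ} {G : SimpleGraph V} {H : G.Subgraph}

/-- A homomorphic image of `H` suffices to keep the chromatic number at least `k`. An inclusion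
serves for deletion and reattachment, the shift for slides. -/
theorem InChromaticFamily.of_hom (hG : G.InChromaticFamily k n)
    (hH : H.coe.chromaticNumber = k) {G' : SimpleGraph V} (hconn : G'.Connected)
    (hcol : G'.Colorable k) (f : H.coe →g G') : G'.InChromaticFamily k n :=
  ⟨hG.card_eq, hconn, le_antisymm hcol.chromaticNumber_le
    (hH ▸ chromaticNumber_mono_of_hom f)⟩

theorem InChromaticFamily.colorable (hG : G.InChromaticFamily k n) : G.Colorable k :=
  chromaticNumber_le_iff_colorable.1 hG.chromaticNumber_eq.le

theorem InChromaticFamily.two_le_of_adj (hG : G.InChromaticFamily k n) {a b : V}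
    (hab : G.Adj a b) : 2 ≤ k := by
  have := two_le_chromaticNumber_of_adj hab
  rw [hG.chromaticNumber_eq] at this
  exact_mod_cast this

namespace MaximizesDistanceSpectralRadius

/-- Averaging with both graphs equal to `G` minus the edge: no distance drops, and that from `a` to
`b` exceeds one. -/
theorem isBridge (hG : G.MaximizesDistanceSpectralRadius k n) (hH : H.coe.chromaticNumber = k)
    {a b : V} (hab : G.Adj a b) (hHab : ¬ H.Adj a b) : G.IsBridge s(a, b) := by
  by_contra hbr
  have hconn := hG.1.connected.connected_delete_edge_of_not_isBridge hbr
  have hf : (G.deleteEdges {s(a, b)}).InChromaticFamily k n := by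
    refine hG.1.of_hom hH hconn (hG.1.colorable.mono_left (deleteEdges_le _))
      ⟨fun x => x.1, fun {x y} hxy => ?_⟩
    rw [deleteEdges_adj]
    refine ⟨H.adj_sub hxy, fun h => ?_⟩
    rcases Sym2.eq_iff.1 h with ⟨h1, h2⟩ | ⟨h1, h2⟩
    · exact hHab (h1 ▸ h2 ▸ hxy)
    · exact hHab (h1 ▸ h2 ▸ H.adj_symm hxy)
  have h := hG.two_mul_dist_eq hf hf (fun i j => by
    have := (hconn.preconnected i j).dist_anti (deleteEdges_le {s(a, b)})
    omega) a b
  have h1 := dist_eq_one_iff_adj.2 hab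
  have h2 := hconn.one_lt_dist_of_ne_of_not_adj hab.ne (by simp)
  omega

/-- The branch behind `b` is reattached at `c` and at `d`. As `wc` is a bridge, the distance from
`w` is at most the average of those from `c` and `d`, so nothing is lost on average, while the
distance from `b` to `w` rises to at least two in both graphs. -/
theorem not_three_adj (hG : G.MaximizesDistanceSpectralRadius k n)
    (hH : H.coe.chromaticNumber = k) {w b c d : V} (hb : G.Adj w b) (hc : G.Adj w c)
    (hd : G.Adj w d) (hbc : b ≠ c) (hbd : b ≠ d) (hcd : c ≠ d) (hHb : ¬ H.Adj w b)
    (hHc : ¬ H.Adj w c) : False := by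
  have hconn := hG.1.connected
  obtain ⟨B, hB⟩ := (hG.isBridge hH hb hHb).exists_isBridgeSide hb
  obtain ⟨C, hC⟩ := (hG.isBridge hH hc hHc).exists_isBridgeSide hc
  have hcB : c ∉ B := fun h => hbc (hB.eq_of_adj c h w hB.notMem hc.symm).1.symm
  have hdB : d ∉ B := fun h => hbd (hB.eq_of_adj d h w hB.notMem hd.symm).1.symm
  have hfam : ∀ x, x ∉ B → ∃ G' : SimpleGraph V, G'.InChromaticFamily k n ∧
      (∀ i j, (i ∈ B ↔ j ∈ B) → G.dist i j ≤ G'.dist i j) ∧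
      (∀ i ∈ B, ∀ j ∉ B, G.dist i b + 1 + G.dist x j ≤ G'.dist i j) := by
    intro x hx
    obtain ⟨G', h1, h2, h3, h4, h5⟩ := hB.exists_reattach hconn hx
    refine ⟨G', hG.1.of_hom hH h1 (h2 k (hG.1.two_le_of_adj hb) hG.1.colorable)
      ⟨fun x => x.1, fun {x y} hxy => h3 _ _ (H.adj_sub hxy) fun h => ?_⟩, h4, h5⟩
    rcases Sym2.eq_iff.1 h with ⟨h1, h2⟩ | ⟨h1, h2⟩
    · exact hHb (h1 ▸ h2 ▸ hxy)
    · exact hHb (h1 ▸ h2 ▸ H.adj_symm hxy)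
  obtain ⟨G₁, f₁, s₁, d₁⟩ := hfam c hcB
  obtain ⟨G₂, f₂, s₂, d₂⟩ := hfam d hdB
  have hcross : ∀ i ∈ B, ∀ j ∉ B, 2 * G.dist i j ≤ G₁.dist i j + G₂.dist i j := by
    intro i hi j hj
    have e1 := d₁ i hi j hj
    have e2 := d₂ i hi j hj
    have e3 := hC.two_mul_dist_le hconn hd hcd.symm j
    have e4 := hconn.dist_triangle (u := i) (v := b) (w := j)
    have e5 := hconn.dist_triangle (u := b) (v := w) (w := j)
    rw [dist_eq_one_iff_adj.2 hb.symm] at e5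
    omega
  have h := hG.two_mul_dist_eq f₁ f₂ (fun i j => by
    by_cases hij : i ∈ B ↔ j ∈ B
    · have := s₁ i j hij
      have := s₂ i j hij
      omega
    · by_cases hi : i ∈ B
      · exact hcross i hi j fun hj => hij ⟨fun _ => hj, fun _ => hi⟩
      · have := hcross j (by tauto) i hi
        rwa [G.dist_comm, G₁.dist_comm, G₂.dist_comm] at this) b w
  have e1 := d₁ b hB.mem w hB.notMem
  have e2 := d₂ b hB.mem w hB.notMem
  rw [dist_eq_one_iff_adj.2 hb.symm] at h
  rw [dist_eq_one_iff_adj.2 hc.symm] at e1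
  rw [dist_eq_one_iff_adj.2 hd.symm] at e2
  omega

theorem not_adj_of_branches (hG : G.MaximizesDistanceSpectralRadius k n)
    (hH : H.coe.chromaticNumber = k) (hHc : H.Connected) (hk : 3 ≤ k) {u u' v v' : V}
    (huv : H.Adj u v) (hu : G.Adj u u') (hv : G.Adj v v') (hHu : ¬ H.Adj u u')
    (hHv : ¬ H.Adj v v') : False := by
  classical
  obtain ⟨B, hB⟩ := (hG.isBridge hH hu hHu).exists_isBridgeSide hu
  obtain ⟨C, hC⟩ := (hG.isBridge hH hv hHv).exists_isBridgeSide hv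
  have huH := H.edge_vert huv
  have hvH := H.edge_vert huv.symm
  have hHB : ∀ a ∈ H.verts, a ∉ B := fun a ha => hB.disjoint_verts hHc huH hHu ha
  have hHC : ∀ a ∈ H.verts, a ∉ C := fun a ha => hC.disjoint_verts hHc hvH hHv ha
  have hp : G.IsBranchPair B C u u' v v' :=
    ⟨hG.1.connected, hB, hC, H.adj_sub huv, hHB v hvH, hHC u huH⟩
  have hfam : ∀ {B C u u' v v'}, G.IsBranchPair B C u u' v v' → (∀ a ∈ H.verts, a ∉ B) →
      (∀ a ∈ H.verts, a ∉ C) → (G.slide B C u u' v).InChromaticFamily k n := by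
    intro B C u u' v v' hp hHB hHC
    exact hG.1.of_hom hH hp.slide_connected (hp.slide_colorable hG.1.colorable)
      ⟨fun x => shiftAlong u u' v x.1, fun {x y} hxy => hp.slide_adj_shiftAlong (hHB _ x.2)
        (hHC _ x.2) (hHB _ y.2) (hHC _ y.2) (H.adj_sub hxy)⟩
  -- The strict gain needs a core vertex. It exists because a graph on `u` and `v` alone is
  -- 2-colourable, against `k ≥ 3`.
  obtain ⟨z, hz, hzu, hzv⟩ : ∃ z ∈ H.verts, z ≠ u ∧ z ≠ v := by
    by_contra! hno
    have hcol : H.coe.Colorable 2 := by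
      refine ⟨Coloring.mk (fun a => if a.1 = u then (0 : Fin 2) else 1) fun {a c} hac => ?_⟩
      have hne : a.1 ≠ c.1 := (H.adj_sub hac).ne
      have h1 := hno a.1 a.2
      have h2 := hno c.1 c.2
      by_cases ha : a.1 = u <;> by_cases hc : c.1 = u
      · exact absurd (ha.trans hc.symm) hne
      · simp [ha, hc]
      · simp [ha, hc]
      · exact absurd ((h1 ha).trans (h2 hc).symm) hne
    have := hcol.chromaticNumber_le
    rw [hH] at this
    have : k ≤ 2 := by exact_mod_cast this
    omega
  have heq := hG.two_mul_dist_eq (hfam hp hHB hHC) (hfam hp.symm hHC hHB) hp.two_mul_dist_le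
  have hlt := hp.two_mul_dist_add_dist_lt ⟨hHB z hz, hHC z hz, hzu, hzv⟩
  have h1 := heq z u
  have h2 := heq z v
  omega

end MaximizesDistanceSpectralRadius

end Maximal

/-! ### Assembling the attached paths. -/

theorem Walk.IsPath.exists_two_neighbors {G : SimpleGraph V} {u v a : V} {p : G.Walk u v}
    (hp : p.IsPath) (ha : a ∈ p.support) (hau : a ≠ u) (hav : a ≠ v) :
    ∃ b c, b ≠ c ∧ s(a, b) ∈ p.edges ∧ s(a, c) ∈ p.edges := by
  obtain ⟨i, rfl, hi⟩ := Walk.mem_support_iff_exists_getVert.1 ha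
  have hi0 : i ≠ 0 := by
    rintro rfl
    exact hau p.getVert_zero
  have hil : i ≠ p.length := by
    rintro rfl
    exact hav p.getVert_length
  refine ⟨p.getVert (i - 1), p.getVert (i + 1), fun h => ?_, ?_, ?_⟩
  · have := hp.getVert_injOn (show i - 1 ∈ {i | i ≤ p.length} from by simp; omega)
      (show i + 1 ∈ {i | i ≤ p.length} from by simp; omega) h
    omega
  · have := p.toSubgraph_adj_getVert (i := i - 1) (by omega)
    rw [show i - 1 + 1 = i by omega] at this
    exact Walk.adj_toSubgraph_iff_mem_edges.1 this.symm
  · exact Walk.adj_toSubgraph_iff_mem_edges.1 (p.toSubgraph_adj_getVert (by omega))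

/-- A longest path that starts at `v` and meets `s` at most in `v`. -/
theorem exists_longest_path_avoiding [Fintype V] (G : SimpleGraph V) (s : Set V) (v : V) :
    ∃ (e : V) (p : G.Walk v e), p.IsPath ∧ (∀ x ∈ p.support, x ∈ s → x = v) ∧
      ∀ (e' : V) (q : G.Walk v e'), q.IsPath → (∀ x ∈ q.support, x ∈ s → x = v) →
        q.length ≤ p.length := by
  let S : Set ℕ := {m | ∃ (e : V) (p : G.Walk v e), p.IsPath ∧
    (∀ x ∈ p.support, x ∈ s → x = v) ∧ p.length = m}
  have hne : S.Nonempty := ⟨0, v, Walk.nil, Walk.IsPath.nil, by simp, rfl⟩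
  have hbdd : BddAbove S := ⟨Fintype.card V, by
    rintro m ⟨e, p, hp, -, rfl⟩
    exact hp.length_lt.le⟩
  obtain ⟨e, p, hp, hs, hlen⟩ := Nat.sSup_mem hne hbdd
  exact ⟨e, p, hp, hs, fun e' q hq hqs => hlen ▸ le_csSup hbdd ⟨e', q, hq, hqs, rfl⟩⟩

theorem Subgraph.Connected.reachable_deleteEdges {G : SimpleGraph V} {H : G.Subgraph}
    (hH : H.Connected) {a b x y : V} (hab : ¬ H.Adj a b) (hx : x ∈ H.verts) (hy : y ∈ H.verts) :
    (G.deleteEdges {s(a, b)}).Reachable x y := by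
  refine (hH.coe.preconnected ⟨x, hx⟩ ⟨y, hy⟩).of_forall_adj Subtype.val fun c d hcd => ?_
  refine Adj.reachable (SimpleGraph.deleteEdges_adj.2 ⟨H.adj_sub hcd, fun h => ?_⟩)
  rcases Sym2.eq_iff.1 h with ⟨h1, h2⟩ | ⟨h1, h2⟩
  · exact hab (h1 ▸ h2 ▸ hcd)
  · exact hab (h1 ▸ h2 ▸ H.adj_symm hcd)

theorem Walk.reachable_deleteEdges {G : SimpleGraph V} {u v a b x y : V} (p : G.Walk u v)
    (hab : s(a, b) ∉ p.edges) (hx : x ∈ p.support) (hy : y ∈ p.support) :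
    (G.deleteEdges {s(a, b)}).Reachable x y := by
  classical
  have key : ∀ z ∈ p.support, (G.deleteEdges {s(a, b)}).Reachable u z := fun z hz =>
    reachable_deleteEdges_iff_exists_walk.2
      ⟨p.takeUntil z hz, fun h => hab (p.edges_takeUntil_subset_edges hz h)⟩
  exact (key x hx).symm.trans (key y hy)

/-- Let `H` be a connected subgraph such that all other edges are bridges, each vertex of `H`
is on at most one of them, and the vertices outside `H` have degree at most two. Then the graph
arises from `H` by attaching paths. -/
theorem Subgraph.Connected.nonempty_pathAttachment [Fintype V] {G : SimpleGraph V}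
    (hG : G.Connected) {H : G.Subgraph} (hH : H.Connected)
    (hbr : ∀ a b, G.Adj a b → ¬ H.Adj a b → G.IsBridge s(a, b))
    (hin : ∀ v ∈ H.verts, ∀ a b, G.Adj v a → G.Adj v b → ¬ H.Adj v a → ¬ H.Adj v b → a = b)
    (hout : ∀ v ∉ H.verts, ∀ a b c, G.Adj v a → G.Adj v b → G.Adj v c →
      a = b ∨ a = c ∨ b = c) : Nonempty (PathAttachment H) := by
  classical
  choose e p hp hps hmax using fun v : H.verts => G.exists_longest_path_avoiding H.verts (v : V)
  -- A vertex outside `H` and off the path that is adjacent to its end would extend the path.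
  have hext : ∀ (v : H.verts) (b : V), G.Adj (e v) b → b ∉ (p v).support → b ∉ H.verts → False := by
    intro v b hadj hb hbH
    have := hmax v b ((p v).concat hadj) ((hp v).concat hb hadj) (fun x hx hxH => by
      rw [Walk.support_concat, List.mem_append, List.mem_singleton] at hx
      rcases hx with hx | rfl
      · exact hps v x hx hxH
      · exact absurd hxH hbH)
    rw [Walk.length_concat] at this
    omega
  -- The union of `H` and the longest paths is closed under adjacency in `G`, so by connectivity it
  -- is everything. A missing edge `ab` is a bridge, hence `b` lies neither in `H` nor on the path
  -- through `a`; it would then extend the path or violate a degree bound.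
  have hunion : ∀ a ∈ (H ⊔ ⨆ v, (p v).toSubgraph).verts, ∀ b, G.Adj a b →
      (H ⊔ ⨆ v, (p v).toSubgraph).Adj a b := by
    intro a ha b hab
    rw [Subgraph.sup_adj]
    by_cases hHab : H.Adj a b
    · exact Or.inl hHab
    refine Or.inr ?_
    rw [Subgraph.iSup_adj]
    have hbridge := isBridge_iff.1 (hbr a b hab hHab)
    by_cases haH : a ∈ H.verts
    · refine ⟨⟨a, haH⟩, ?_⟩
      rw [Walk.adj_toSubgraph_iff_mem_edges]
      by_contra hnot
      have hbH : b ∉ H.verts := fun hbH => hbridge (hH.reachable_deleteEdges hHab haH hbH)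
      have hbp : b ∉ (p ⟨a, haH⟩).support := fun hb =>
        hbridge (Walk.reachable_deleteEdges _ hnot (Walk.start_mem_support _) hb)
      by_cases hnil : (p ⟨a, haH⟩).Nil
      · exact hext ⟨a, haH⟩ b (hnil.eq ▸ hab) hbp hbH
      · have h1 := (p ⟨a, haH⟩).adj_snd hnil
        have h2 : (p ⟨a, haH⟩).snd ∉ H.verts := fun h =>
          h1.ne (hps ⟨a, haH⟩ _ (Walk.getVert_mem_support _ _) h).symm
        have h3 := hin a haH _ b h1 hab (fun h => h2 (H.edge_vert h.symm)) hHab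
        exact hbp (h3 ▸ Walk.getVert_mem_support _ _)
    · obtain ⟨v, hav⟩ : ∃ v, a ∈ (p v).support := by
        rw [Subgraph.verts_sup, Subgraph.verts_iSup] at ha
        rcases ha with ha | ha
        · exact absurd ha haH
        · obtain ⟨v, hv⟩ := Set.mem_iUnion.1 ha
          exact ⟨v, (Walk.mem_verts_toSubgraph _).1 hv⟩
      refine ⟨v, ?_⟩
      rw [Walk.adj_toSubgraph_iff_mem_edges]
      by_contra hnot
      have hva := Walk.reachable_deleteEdges _ hnot hav (Walk.start_mem_support _)
      have hbH : b ∉ H.verts := fun hbH =>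
        hbridge (hva.trans (hH.reachable_deleteEdges hHab v.2 hbH))
      have hbp : b ∉ (p v).support := fun hb =>
        hbridge (Walk.reachable_deleteEdges _ hnot hav hb)
      by_cases hae : a = e v
      · subst hae
        exact hext v b hab hbp hbH
      · obtain ⟨c, d, hcd, hc, hd⟩ := (hp v).exists_two_neighbors hav
          (fun h => haH (h ▸ v.2)) hae
        have hc' := (p v).snd_mem_support_of_mem_edges hc
        have hd' := (p v).snd_mem_support_of_mem_edges hd
        rcases hout a haH b c d hab ((p v).adj_of_mem_edges hc) ((p v).adj_of_mem_edges hd) with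
          h | h | h
        · exact hbp (h ▸ hc')
        · exact hbp (h ▸ hd')
        · exact hcd h
  refine ⟨⟨e, p, hp, hps, ?_, ?_⟩⟩
  · intro v w hvw x hxv hxw
    -- A common vertex `x` gives a detour around the first edge of the path at `v`, which is a
    -- bridge: through `H` to `w`, along its path to `x`, and back along the tail of the path at
    -- `v`.
    have hxv' : x ≠ v := fun h => hvw (Subtype.ext (hps w v (h ▸ hxw) v.2))
    have hnil : ¬ (p v).Nil := fun h => by
      rw [Walk.nil_iff_support_eq.1 h, List.mem_singleton] at hxv
      exact hxv' hxv
    have hadj := (p v).adj_snd hnil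
    have hsnd : (p v).snd ∉ H.verts := fun h =>
      hadj.ne (hps v _ (Walk.getVert_mem_support _ _) h).symm
    have hHadj : ¬ H.Adj v (p v).snd := fun h => hsnd (H.edge_vert h.symm)
    refine isBridge_iff.1 (hbr _ _ hadj hHadj) ?_
    have hvw' : (v : V) ∉ (p w).support := fun h => hvw (Subtype.ext (hps w v h v.2))
    have h1 := hH.reachable_deleteEdges hHadj v.2 w.2
    have h2 := (p w).reachable_deleteEdges (a := (v : V)) (b := (p v).snd)
      (fun h => hvw' ((p w).fst_mem_support_of_mem_edges h)) (p w).start_mem_support hxw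
    have hcons := (p v).cons_tail_eq hnil
    have hpath := hp v
    rw [← hcons, Walk.cons_isPath_iff] at hpath
    have hxt : x ∈ (p v).tail.support := by
      rw [← hcons, Walk.support_cons, List.mem_cons] at hxv
      exact hxv.resolve_left hxv'
    have h3 := (p v).tail.reachable_deleteEdges (a := (v : V)) (b := (p v).snd)
      (fun h => hpath.2 ((p v).tail.fst_mem_support_of_mem_edges h)) hxt
      (p v).tail.start_mem_support
    exact (h1.trans h2).trans h3
  · obtain ⟨v, hv⟩ := hH.nonempty
    have hverts : ∀ a, a ∈ (H ⊔ ⨆ v, (p v).toSubgraph).verts :=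
      hG.preconnected.induction_adj (a := v) (Or.inl hv) fun a c hac ha =>
        Subgraph.edge_vert _ (hunion a ha c hac).symm
    exact top_le_iff.1 ⟨fun a _ => hverts a, fun a b hab => hunion a (hverts a) b hab⟩

theorem PathAttachment.exists_adj_of_mem_nontrivialVerts {G : SimpleGraph V} {H : G.Subgraph}
    (A : PathAttachment H) {v : H.verts} (hv : v ∈ A.nontrivialVerts) :
    ∃ a, G.Adj v a ∧ ¬ H.Adj v a := by
  have hnil : ¬ (A.path v).Nil := Walk.not_nil_iff_lt_length.2 hv
  have hadj := (A.path v).adj_snd hnil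
  exact ⟨_, hadj, fun h =>
    hadj.ne (A.eq_of_mem v _ (Walk.getVert_mem_support _ _) (H.edge_vert h.symm)).symm⟩

/-- If all edges but one at a vertex `l` whose removal does not disconnect the graph are bridges,
then `l` is a leaf. -/
theorem eq_of_adj_of_connected_compl {G : SimpleGraph V} {l m a : V} (hl : (G.induce {l}ᶜ).Preconnected)
    (hm : G.Adj l m) (ha : G.Adj l a) (hbr : a ≠ m → G.IsBridge s(l, a)) : a = m := by
  by_contra hne
  refine isBridge_iff.1 (hbr hne) ?_
  have h1 : (G.deleteEdges {s(l, a)}).Adj l m := by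
    rw [deleteEdges_adj]
    refine ⟨hm, fun h => ?_⟩
    rcases Sym2.eq_iff.1 h with ⟨-, h⟩ | ⟨h, -⟩
    · exact hne h.symm
    · exact ha.ne h
  refine h1.reachable.trans ?_
  refine (hl ⟨m, hm.ne'⟩ ⟨a, ha.ne'⟩).of_forall_adj Subtype.val fun c d hcd => ?_
  refine Adj.reachable ?_
  rw [deleteEdges_adj]
  refine ⟨hcd, fun h => ?_⟩
  rcases Sym2.eq_iff.1 h with ⟨h, -⟩ | ⟨-, h⟩
  · exact c.2 h
  · exact d.2 h

section Maximal

variable [Fintype V] {k n : ℕ} {G : SimpleGraph V} {H : G.Subgraph}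

theorem MaximizesDistanceSpectralRadius.nonempty_pathAttachment
    (hG : G.MaximizesDistanceSpectralRadius k n) (hH : H.coe.chromaticNumber = k)
    (hHc : H.Connected) : Nonempty (PathAttachment H) := by
  refine Subgraph.Connected.nonempty_pathAttachment hG.1.connected hHc
    (fun a b => hG.isBridge hH) ?_ ?_
  · intro v hv a b ha hb hHa hHb
    by_contra hab
    have h2 : (2 : ℕ∞) ≤ H.coe.chromaticNumber := by
      rw [hH]
      exact_mod_cast hG.1.two_le_of_adj ha
    obtain ⟨x, y, hxy⟩ := ne_bot_iff_exists_adj.1 (two_le_chromaticNumber_iff_ne_bot.1 h2)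
    have : Nontrivial H.verts := ⟨x, y, hxy.ne⟩
    obtain ⟨c, hc⟩ := hHc.coe.preconnected.exists_adj_of_nontrivial ⟨v, hv⟩
    exact hG.not_three_adj hH ha hb (H.adj_sub hc) hab (fun h => hHa (h ▸ hc))
      (fun h => hHb (h ▸ hc)) hHa hHb
  · intro v hv a b c ha hb hc
    by_contra! hne
    exact hG.not_three_adj hH ha hb hc hne.1 hne.2.1 hne.2.2 (fun h => hv (H.edge_vert h))
      (fun h => hv (H.edge_vert h))

end Maximal

end SimpleGraph

theorem mainTheorem4 {V : Type u} [Fintype V] (k n : ℕ) (G : SimpleGraph V)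
    (hG : G.MaximizesDistanceSpectralRadius k n) :
    ∃ H : G.Subgraph, H.coe.IsCritical k ∧
      ∃ A : SimpleGraph.PathAttachment H, H.coe.IsIndepSet A.nontrivialVerts := by
  have hconn := hG.1.connected
  have hk0 : k ≠ 0 := by
    rintro rfl
    have h := hG.1.chromaticNumber_eq
    rw [Nat.cast_zero, SimpleGraph.chromaticNumber_eq_zero_iff] at h
    exact not_nonempty_iff.2 h hconn.nonempty
  -- For `k = 2`, a non-cut vertex `l` is a leaf because its edges other than `lm` are bridges. With
  -- `H` inside the edge `lm`, no nontrivial path starts at `l`.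
  by_cases hk : k = 2
  · subst hk
    have h2 : (2 : ℕ∞) ≤ G.chromaticNumber := by
      rw [hG.1.chromaticNumber_eq]
      rfl
    obtain ⟨x, y, hxy⟩ :=
      SimpleGraph.ne_bot_iff_exists_adj.1 (SimpleGraph.two_le_chromaticNumber_iff_ne_bot.1 h2)
    have : Nontrivial V := ⟨x, y, hxy.ne⟩
    obtain ⟨l, hl⟩ := hconn.exists_preconnected_induce_compl_singleton_of_finite
    obtain ⟨m, hm⟩ := hconn.preconnected.exists_adj_of_nontrivial l
    have hedge : (G.subgraphOfAdj hm).coe.chromaticNumber = (2 : ℕ) := by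
      refine le_antisymm ?_ ?_
      · rw [← hG.1.chromaticNumber_eq]
        exact SimpleGraph.chromaticNumber_mono_of_hom (SimpleGraph.Subgraph.hom _)
      · exact SimpleGraph.two_le_chromaticNumber_of_adj
          (u := ⟨l, by simp⟩) (v := ⟨m, by simp⟩) (by simp)
    obtain ⟨H, hle, hH⟩ := SimpleGraph.Subgraph.exists_isCritical_le _ hedge
    obtain ⟨A⟩ := hG.nonempty_pathAttachment hH.1 ⟨hH.connected hk0⟩
    have hleaf : ∀ a, G.Adj l a → a = m := fun a ha =>
      SimpleGraph.eq_of_adj_of_connected_compl hl hm ha fun hne =>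
        hG.isBridge hedge ha (by
          have := ha.ne
          simp
          tauto)
    refine ⟨H, hH, A, ?_⟩
    have key : ∀ u v : H.verts, u ∈ A.nontrivialVerts → H.Adj u v → (u : V) ≠ l := by
      intro u v hu huv hul
      obtain ⟨a, ha, hHa⟩ := A.exists_adj_of_mem_nontrivialVerts hu
      rw [hul] at ha huv hHa
      rw [hleaf a ha, ← hleaf v (H.adj_sub huv)] at hHa
      exact hHa huv
    intro u hu v hv _ huv
    have h1 := key u v hu huv
    have h2 := key v u hv huv.symm
    have h3 := hle.2 huv
    simp at h3
    tauto
  · obtain ⟨H, -, hH⟩ := SimpleGraph.Subgraph.exists_isCritical_le (k := k) (⊤ : G.Subgraph) (by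
      rw [← hG.1.chromaticNumber_eq]
      exact SimpleGraph.chromaticNumber_congr SimpleGraph.Subgraph.topIso)
    have hHc : H.Connected := ⟨hH.connected hk0⟩
    obtain ⟨A⟩ := hG.nonempty_pathAttachment hH.1 hHc
    refine ⟨H, hH, A, ?_⟩
    intro u hu v hv _ huv
    obtain ⟨a, ha, hHa⟩ := A.exists_adj_of_mem_nontrivialVerts hu
    obtain ⟨b, hb, hHb⟩ := A.exists_adj_of_mem_nontrivialVerts hv
    -- A nontrivial path provides an edge, so `k = 1` is excluded here and `k ≥ 3` follows.
    have := hG.1.two_le_of_adj ha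
    exact hG.not_adj_of_branches hH.1 hHc (by omega) huv ha hb hHa hHb
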